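/- There are universal constants $c_0>0$ and $c>0$ such that the following holds. Let $\mathbb{K}$ be $\mathbb{R}$ or $\mathbb{C}$ and let $A\in\mathbb{K}^{m\times n}$ be a nonzero matrix with rank $k$ and stable rank $r:=\|A\|_F^2/\|A\|_2^2$, where $\|\cdot\|_F$ is the Frobenius norm and $\|\cdot\|_2$ the spectral norm (the Euclidean norm on rows and columns). Let $\kappa(A):=\sigma_{\max}(A)/\sigma_{\min}(A)$, where $\sigma_{\max}(A)$ and $\sigma_{\min}(A)$ are the largest and the smallest nonzero singular value of $A$. Put \[ \alpha:=\frac{1}{\sqrt m}\min\Big\{\frac{\|A\|_F}{\|A(i,:)\|_2}: A(i,:)\neq 0\Big\},\qquad \beta:=\frac{1}{\sqrt n}\min\Big\{\frac{\|A\|_F}{\|A(:,j)\|_2}: A(:,j)\neq 0\Big\},\qquad \gamma:=\min\{\alpha,\beta\}. \] Let $\delta\in(0,1)$, let $0<\varepsilon<\min\{\kappa(A)^{-1},\ \delta^{-1/4}\sqrt{2\gamma}\}$, and let $d_1,d_2$ be natural numbers with \[ d_1,\,d_2\ \ge\ c_0\,\frac{r}{\varepsilon^4\delta}\log\Big(\frac{r}{\varepsilon^4\delta}\Big).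 \] Draw row indices $I=(i_1,\dots,i_{d_1})$ from $\{1,\dots,m\}$ and column indices $J=(j_1,\dots,j_{d_2})$ from $\{1,\dots,n\}$, all independently, uniformly and with replacement, and set $C:=A(:,J)$, $R:=A(I,:)$, $U:=A(I,J)$ (repetitions kept). Then, with $x_+:=\max\{0,x\}$ and $U^\dagger$ the Moore--Penrose pseudoinverse of $U$, \[ \mathbb{P}\big(\operatorname{rank}(U)=k\ \text{ and }\ A=CU^\dagger R\big)\ \ge\ \Big(1-2e^{-c\alpha^2/\delta}\Big)_+\Big(1-2e^{-c\beta^2/\delta}\Big)_+ . \] -/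

import Mathlib

open scoped Matrix

/-- `X` is the Moore–Penrose pseudoinverse of `A`: the four Penrose conditions. -/
structure IsMoorePenrose {𝕜 : Type*} [RCLike 𝕜] {m n : Type*} [Fintype m] [Fintype n]
    (A : Matrix m n 𝕜) (X : Matrix n m 𝕜) : Prop where
  mul_mul_self : A * X * A = A
  self_mul_mul : X * A * X = X
  isHermitian_left : (A * X).IsHermitian
  isHermitian_right : (X * A).IsHermitian

theorem IsMoorePenrose.unique {𝕜 : Type*} [RCLike 𝕜] {m n : Type*} [Fintype m] [Fintype n]
    {A : Matrix m n 𝕜} {X Y : Matrix n m 𝕜}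
    (hX : IsMoorePenrose A X) (hY : IsMoorePenrose A Y) : X = Y := by
  have h1 : A * X = A * Y := by
    have e1 : (A * X * (A * Y))ᴴ = A * Y * (A * X) := by
      rw [Matrix.conjTranspose_mul, hX.isHermitian_left.eq, hY.isHermitian_left.eq]
    have e2 : A * X * (A * Y) = A * Y := by
      rw [← Matrix.mul_assoc, hX.mul_mul_self]
    have e3 : A * Y * (A * X) = A * X := by
      rw [← Matrix.mul_assoc, hY.mul_mul_self]
    rw [e2, e3, hY.isHermitian_left.eq] at e1
    exact e1.symm
  have h2 : X * A = Y * A := by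
    have e1 : (X * A * (Y * A))ᴴ = Y * A * (X * A) := by
      rw [Matrix.conjTranspose_mul, hX.isHermitian_right.eq, hY.isHermitian_right.eq]
    have e2 : X * A * (Y * A) = X * A := by
      rw [Matrix.mul_assoc, ← Matrix.mul_assoc A, hY.mul_mul_self]
    have e3 : Y * A * (X * A) = Y * A := by
      rw [Matrix.mul_assoc, ← Matrix.mul_assoc A, hX.mul_mul_self]
    rw [e2, e3, hX.isHermitian_right.eq] at e1
    exact e1
  calc X = X * A * X := hX.self_mul_mul.symm
    _ = Y * (A * X) := by rw [h2, Matrix.mul_assoc]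
    _ = Y * A * Y := by rw [h1, Matrix.mul_assoc]
    _ = Y := hY.self_mul_mul

theorem exists_isMoorePenrose_hermitian {𝕜 : Type*} [RCLike 𝕜] {n : Type*} [Fintype n]
    [DecidableEq n] (H : Matrix n n 𝕜) (hH : H.IsHermitian) : ∃ G : Matrix n n 𝕜, G.IsHermitian ∧
      H * G * H = H ∧ G * H = H * G ∧ G * H * G = G := by
  set V : Matrix n n 𝕜 := (hH.eigenvectorUnitary : Matrix n n 𝕜) with hV
  have hVV : Vᴴ * V = 1 := Unitary.coe_star_mul_self hH.eigenvectorUnitary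
  set D : Matrix n n 𝕜 := Matrix.diagonal (RCLike.ofReal ∘ hH.eigenvalues) with hD
  set E : Matrix n n 𝕜 := Matrix.diagonal fun i => ((hH.eigenvalues i)⁻¹ : ℝ) with hE
  have hs : H = V * D * Vᴴ := by
    have := hH.spectral_theorem
    rwa [Unitary.conjStarAlgAut_apply] at this
  have key : ∀ P Q : Matrix n n 𝕜, V * P * Vᴴ * (V * Q * Vᴴ) = V * (P * Q) * Vᴴ := by
    intro P Q
    calc V * P * Vᴴ * (V * Q * Vᴴ) = V * P * (Vᴴ * V) * Q * Vᴴ := by simp only [Matrix.mul_assoc]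
      _ = _ := by rw [hVV]; simp only [Matrix.mul_assoc, Matrix.mul_one]
  refine ⟨V * E * Vᴴ, ?_, ?_, ?_, ?_⟩
  · have : Eᴴ = E := by
      rw [hE, Matrix.diagonal_conjTranspose]; congr 1; ext i; simp
    rw [Matrix.IsHermitian, Matrix.conjTranspose_mul, Matrix.conjTranspose_mul, this,
      Matrix.conjTranspose_conjTranspose, Matrix.mul_assoc]
  · rw [hs, key, key]
    congr 2
    rw [hD, hE, Matrix.diagonal_mul_diagonal, Matrix.diagonal_mul_diagonal]
    congr 1; ext i
    by_cases h : hH.eigenvalues i = 0 <;> simp [h]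
  · rw [hs, key, key]
    congr 2
    rw [hD, hE, Matrix.diagonal_mul_diagonal, Matrix.diagonal_mul_diagonal]
    congr 1; ext i
    simp [mul_comm]
  · rw [hs, key, key]
    congr 2
    rw [hD, hE, Matrix.diagonal_mul_diagonal, Matrix.diagonal_mul_diagonal]
    congr 1; ext i
    by_cases h : hH.eigenvalues i = 0 <;> simp [h]

open scoped ComplexOrder in
theorem exists_isMoorePenrose {𝕜 : Type*} [RCLike 𝕜] {m n : Type*} [Fintype m] [Fintype n]
    (A : Matrix m n 𝕜) : ∃ X : Matrix n m 𝕜, IsMoorePenrose A X := by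
  classical
  obtain ⟨G, hG, h1, h2, h3⟩ := exists_isMoorePenrose_hermitian (Aᴴ * A)
    (Matrix.isHermitian_conjTranspose_mul_self A)
  refine ⟨G * Aᴴ, ?_, ?_, ?_, ?_⟩
  · have : Aᴴ * A * (G * (Aᴴ * A) - 1) = 0 := by
      rw [Matrix.mul_sub, Matrix.mul_one, ← Matrix.mul_assoc, h1, sub_self]
    rw [Matrix.conjTranspose_mul_self_mul_eq_zero, Matrix.mul_sub, Matrix.mul_one,
      sub_eq_zero] at this
    simpa only [Matrix.mul_assoc] using this
  · calc G * Aᴴ * A * (G * Aᴴ) = G * (Aᴴ * A) * G * Aᴴ := by simp only [Matrix.mul_assoc]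
      _ = _ := by rw [h3]
  · rw [Matrix.IsHermitian, Matrix.conjTranspose_mul, Matrix.conjTranspose_mul, hG.eq,
      Matrix.conjTranspose_conjTranspose, Matrix.mul_assoc]
  · rw [Matrix.mul_assoc, Matrix.IsHermitian, Matrix.conjTranspose_mul, hG.eq,
      (Matrix.isHermitian_conjTranspose_mul_self A).eq, h2]

/-- The Moore–Penrose pseudoinverse `A†`. -/
noncomputable def pinv {𝕜 : Type*} [RCLike 𝕜] {m n : Type*} [Fintype m] [Fintype n]
    (A : Matrix m n 𝕜) : Matrix n m 𝕜 :=
  (exists_isMoorePenrose A).choose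

theorem isMoorePenrose_pinv {𝕜 : Type*} [RCLike 𝕜] {m n : Type*} [Fintype m] [Fintype n]
    (A : Matrix m n 𝕜) : IsMoorePenrose A (pinv A) :=
  (exists_isMoorePenrose A).choose_spec

open scoped Matrix.Norms.Frobenius in
/-- The Frobenius norm `‖A‖_F`. -/
noncomputable def frobNorm {𝕜 : Type*} [RCLike 𝕜] {m n : ℕ}
    (A : Matrix (Fin m) (Fin n) 𝕜) : ℝ := ‖A‖

open scoped Matrix.Norms.L2Operator in
/-- The spectral norm `‖A‖₂`: the operator norm for the Euclidean norms. -/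
noncomputable def specNorm {𝕜 : Type*} [RCLike 𝕜] {m n : ℕ}
    (A : Matrix (Fin m) (Fin n) 𝕜) : ℝ := ‖A‖

/-- The stable rank `‖A‖_F² / ‖A‖₂²`. -/
noncomputable def stableRank {𝕜 : Type*} [RCLike 𝕜] {m n : ℕ}
    (A : Matrix (Fin m) (Fin n) 𝕜) : ℝ := frobNorm A ^ 2 / specNorm A ^ 2

/-- The singular values of `A` in decreasing order, indexed from `0`. -/
noncomputable def singVal {𝕜 : Type*} [RCLike 𝕜] {m n : ℕ}
    (A : Matrix (Fin m) (Fin n) 𝕜) (i : ℕ) : ℝ := (Matrix.toEuclideanLin A).singularValues i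

/-- The generalized condition number `κ(A)`: the largest singular value of `A ≠ 0` divided by its
smallest nonzero singular value. -/
noncomputable def condNum {𝕜 : Type*} [RCLike 𝕜] {m n : ℕ}
    (A : Matrix (Fin m) (Fin n) 𝕜) : ℝ := singVal A 0 / singVal A (A.rank - 1)

/-- The Euclidean length `‖A(i,:)‖₂` of a row. -/
noncomputable def rowNorm {𝕜 : Type*} [RCLike 𝕜] {m n : ℕ}
    (A : Matrix (Fin m) (Fin n) 𝕜) (i : Fin m) : ℝ := √(∑ j, ‖A i j‖ ^ 2)

/-- The Euclidean length `‖A(:,j)‖₂` of a column. -/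
noncomputable def colNorm {𝕜 : Type*} [RCLike 𝕜] {m n : ℕ}
    (A : Matrix (Fin m) (Fin n) 𝕜) (j : Fin n) : ℝ := √(∑ i, ‖A i j‖ ^ 2)

/-- `(1/√m) · min {‖A‖_F / ‖A(i,:)‖₂ : A(i,:) ≠ 0}`; for `A ≠ 0` the set is finite and nonempty,
so that its infimum is a minimum. -/
noncomputable def rowParam {𝕜 : Type*} [RCLike 𝕜] {m n : ℕ}
    (A : Matrix (Fin m) (Fin n) 𝕜) : ℝ :=
  1 / √(m : ℝ) * sInf {x : ℝ | ∃ i : Fin m, (∃ j, A i j ≠ 0) ∧ x = frobNorm A / rowNorm A i}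

/-- `(1/√n) · min {‖A‖_F / ‖A(:,j)‖₂ : A(:,j) ≠ 0}`; for `A ≠ 0` the set is finite and nonempty,
so that its infimum is a minimum. -/
noncomputable def colParam {𝕜 : Type*} [RCLike 𝕜] {m n : ℕ}
    (A : Matrix (Fin m) (Fin n) 𝕜) : ℝ :=
  1 / √(n : ℝ) * sInf {x : ℝ | ∃ j : Fin n, (∃ i, A i j ≠ 0) ∧ x = frobNorm A / colNorm A j}

/-- The law of `d` indices drawn from `Fin N` independently, uniformly and with replacement. -/
noncomputable def uniformSample (d N : ℕ) : MeasureTheory.Measure (Fin d → Fin N) :=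
  MeasureTheory.Measure.pi fun _ => ProbabilityTheory.uniformOn Set.univ

/-- `rank U = rank A` and `A = C U† R`, where `C = A(:,J)`, `R = A(I,:)` and `U = A(I,J)` for the
(possibly repeating) lists of row indices `I` and column indices `J`. -/
def IsExactCUR {𝕜 : Type*} [RCLike 𝕜] {m n d₁ d₂ : ℕ} (A : Matrix (Fin m) (Fin n) 𝕜)
    (I : Fin d₁ → Fin m) (J : Fin d₂ → Fin n) : Prop :=
  (A.submatrix I J).rank = A.rank ∧
    A = A.submatrix id J * pinv (A.submatrix I J) * A.submatrix I id

/-! If the sampled rows $R$ and the sampled columns $C$ both have rank $k$, then $A = XR = CY$, so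
$C = XU$, $R = UY$ and $A = XUY = XUU^\dagger UY = CU^\dagger R$ (`isExactCUR_of_rank_eq`). The two
rank events are independent, and the column event is the row event for $A^*$, so it suffices to
bound the row event.

Rows are drawn one at a time. Let $\sigma$ be the smallest nonzero singular value and $M$ a bound
for the squared row norms. The deficit $k - \operatorname{rank} R$ is the dimension of $(\ker
A)^\perp\cap\ker R$, on which $A$ stretches by at least $\sigma$; by Bessel each row carries at most
$M$ of that mass, and only a row that raises the rank carries any (`deficit_mul_sq_le`). Hence each
draw shrinks the expected deficit by a factor $1-\sigma^2/(mM)$, and Markov's inequality bounds the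
failure probability by $k\,e^{-d\sigma^2/(mM)}$ (`uniformSample_real_rank_ne_le`). With
$M=\|A\|_F^2/(m\alpha^2)$ the exponent is at least $(\alpha^2/\delta)\log s$, where
$s=r/(\varepsilon^4\delta)\ge k$. -/

/-! ### Expected rank deficit of randomly chosen rows -/

section RankGrowth

variable {𝕜 : Type*} [RCLike 𝕜] {m n : ℕ}

theorem finrank_range_toEuclideanLin (A : Matrix (Fin m) (Fin n) 𝕜) :
    Module.finrank 𝕜 (LinearMap.range (Matrix.toEuclideanLin A)) = A.rank := by
  rw [Matrix.toEuclideanLin, Matrix.toLpLin_eq_toLin, ← Matrix.rank_eq_finrank_range_toLin]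

theorem finrank_ker_toEuclideanLin_add_rank (A : Matrix (Fin m) (Fin n) 𝕜) :
    Module.finrank 𝕜 (LinearMap.ker (Matrix.toEuclideanLin A)) + A.rank = n := by
  rw [← finrank_range_toEuclideanLin, add_comm, LinearMap.finrank_range_add_finrank_ker,
    finrank_euclideanSpace_fin]

theorem mem_ker_toEuclideanLin_submatrix {l : ℕ} (A : Matrix (Fin m) (Fin n) 𝕜)
    (I : Fin l → Fin m) (v : EuclideanSpace 𝕜 (Fin n)) :
    v ∈ LinearMap.ker (Matrix.toEuclideanLin (A.submatrix I id)) ↔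
      ∀ t, Matrix.toEuclideanLin A v (I t) = 0 := by
  rw [LinearMap.mem_ker, PiLp.ext_iff]
  rfl

/-- Bessel's inequality for the coefficients of one row of `A`. -/
theorem sum_sq_norm_toEuclideanLin_apply_le {ι : Type*} [Fintype ι]
    (A : Matrix (Fin m) (Fin n) 𝕜) {b : ι → EuclideanSpace 𝕜 (Fin n)} (hb : Orthonormal 𝕜 b)
    (i : Fin m) :
    ∑ t, ‖Matrix.toEuclideanLin A (b t) i‖ ^ 2 ≤ rowNorm A i ^ 2 := by
  have h := hb.sum_inner_products_le (WithLp.toLp 2 (star (A i))) (s := Finset.univ)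
  have e : ‖(WithLp.toLp 2 (star (A i)) : EuclideanSpace 𝕜 (Fin n))‖ = rowNorm A i := by
    simp [EuclideanSpace.norm_eq, rowNorm]
  rw [e] at h
  refine le_trans (le_of_eq (Finset.sum_congr rfl fun t _ => ?_)) h
  congr 1
  rw [norm_inner_symm]
  congr 1
  simp [EuclideanSpace.inner_eq_star_dotProduct, Matrix.toEuclideanLin, Matrix.toLpLin, Matrix.mulVec, dotProduct_comm]

theorem rank_submatrix_row_le {l : ℕ} (A : Matrix (Fin m) (Fin n) 𝕜) (I : Fin l → Fin m) :
    (A.submatrix I id).rank ≤ A.rank := by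
  have h1 := finrank_ker_toEuclideanLin_add_rank A
  have h2 := finrank_ker_toEuclideanLin_add_rank (A.submatrix I id)
  have : LinearMap.ker (Matrix.toEuclideanLin A) ≤
      LinearMap.ker (Matrix.toEuclideanLin (A.submatrix I id)) := fun v hv => by
    rw [mem_ker_toEuclideanLin_submatrix, LinearMap.mem_ker.1 hv]
    simp
  have := Submodule.finrank_mono this
  omega

theorem ker_submatrix_cons_le {l : ℕ} (A : Matrix (Fin m) (Fin n) 𝕜) (I : Fin l → Fin m)
    (i : Fin m) :
    LinearMap.ker (Matrix.toEuclideanLin (A.submatrix (Fin.cons i I : Fin (l + 1) → Fin m) id)) ≤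
      LinearMap.ker (Matrix.toEuclideanLin (A.submatrix I id)) := fun v hv => by
  rw [mem_ker_toEuclideanLin_submatrix] at hv ⊢
  exact fun t => by simpa using hv t.succ

theorem rank_submatrix_le_cons {l : ℕ} (A : Matrix (Fin m) (Fin n) 𝕜) (I : Fin l → Fin m)
    (i : Fin m) :
    (A.submatrix I id).rank ≤ (A.submatrix (Fin.cons i I : Fin (l + 1) → Fin m) id).rank := by
  have h1 := finrank_ker_toEuclideanLin_add_rank (A.submatrix I id)
  have h2 := finrank_ker_toEuclideanLin_add_rank
    (A.submatrix (Fin.cons i I : Fin (l + 1) → Fin m) id)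
  have := Submodule.finrank_mono (ker_submatrix_cons_le A I i)
  omega

theorem rank_submatrix_lt_cons {l : ℕ} (A : Matrix (Fin m) (Fin n) 𝕜) (I : Fin l → Fin m)
    (i : Fin m) {v : EuclideanSpace 𝕜 (Fin n)}
    (hv : v ∈ LinearMap.ker (Matrix.toEuclideanLin (A.submatrix I id)))
    (hi : Matrix.toEuclideanLin A v i ≠ 0) :
    (A.submatrix I id).rank < (A.submatrix (Fin.cons i I : Fin (l + 1) → Fin m) id).rank := by
  have h1 := finrank_ker_toEuclideanLin_add_rank (A.submatrix I id)
  have h2 := finrank_ker_toEuclideanLin_add_rank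
    (A.submatrix (Fin.cons i I : Fin (l + 1) → Fin m) id)
  have := Submodule.finrank_lt_finrank_of_lt ((ker_submatrix_cons_le A I i).lt_of_ne fun h => by
    rw [← h, mem_ker_toEuclideanLin_submatrix] at hv
    exact hi (by simpa using hv 0))
  omega

/-- If `A` is bounded below by `σ` on the orthogonal complement of its kernel, then the number of
rows that increase the rank of `A(I,:)` is at least proportional to the rank deficit. -/
theorem deficit_mul_sq_le {l : ℕ} (A : Matrix (Fin m) (Fin n) 𝕜) {σ M : ℝ} (hσ0 : 0 ≤ σ)
    (hσ : ∀ v ∈ (LinearMap.ker (Matrix.toEuclideanLin A))ᗮ,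
      σ * ‖v‖ ≤ ‖Matrix.toEuclideanLin A v‖)
    (hM : ∀ i, rowNorm A i ^ 2 ≤ M) (I : Fin l → Fin m) :
    ((A.rank : ℝ) - (A.submatrix I id).rank) * σ ^ 2 ≤
      M * ∑ i : Fin m, (((A.submatrix (Fin.cons i I : Fin (l + 1) → Fin m) id).rank : ℝ) -
        (A.submatrix I id).rank) := by
  set T := Matrix.toEuclideanLin A with hT
  set K := LinearMap.ker (Matrix.toEuclideanLin (A.submatrix I id)) with hK
  -- The dimension of `V` is exactly the rank deficit of the chosen rows.
  set V := (LinearMap.ker T)ᗮ ⊓ K with hV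
  have hle : LinearMap.ker T ≤ K := fun v hv => by
    rw [hK, mem_ker_toEuclideanLin_submatrix, ← hT, LinearMap.mem_ker.1 hv]
    simp
  have hfin : (Module.finrank 𝕜 V : ℝ) = (A.rank : ℝ) - (A.submatrix I id).rank := by
    have h0 := Submodule.finrank_add_inf_finrank_orthogonal hle
    have h1 := finrank_ker_toEuclideanLin_add_rank A
    have h2 := finrank_ker_toEuclideanLin_add_rank (A.submatrix I id)
    rw [← hT] at h1
    rw [← hK] at h2
    rw [← hV] at h0
    rw [eq_sub_iff_add_eq]
    norm_cast
    omega
  set b := stdOrthonormalBasis 𝕜 V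
  have hb : Orthonormal 𝕜 fun t => (b t : EuclideanSpace 𝕜 (Fin n)) :=
    b.orthonormal.comp_linearIsometry V.subtypeₗᵢ
  calc ((A.rank : ℝ) - (A.submatrix I id).rank) * σ ^ 2
      = ∑ _t : Fin (Module.finrank 𝕜 V), σ ^ 2 := by simp [hfin]
    _ ≤ ∑ t, ‖T (b t)‖ ^ 2 := by
        refine Finset.sum_le_sum fun t _ => ?_
        have h := hσ (b t) (b t).2.1
        rw [hb.norm_eq_one t, mul_one] at h
        gcongr
    _ = ∑ i, ∑ t, ‖T (b t) i‖ ^ 2 := by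
        simp_rw [EuclideanSpace.norm_sq_eq]
        exact Finset.sum_comm
    _ ≤ ∑ i : Fin m, M * (((A.submatrix (Fin.cons i I : Fin (l + 1) → Fin m) id).rank : ℝ) -
        (A.submatrix I id).rank) := by
        refine Finset.sum_le_sum fun i _ => ?_
        have hM0 : 0 ≤ M := (sq_nonneg _).trans (hM i)
        -- Either row `i` detects a vector of `V` and so raises the rank by at least one, or it
        -- vanishes on `V` and contributes nothing.
        by_cases h : ∃ t, T (b t) i ≠ 0
        · obtain ⟨t, ht⟩ := h
          have h1 := rank_submatrix_lt_cons A I i (b t).2.2 ht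
          have h2 : (1 : ℝ) ≤ ((A.submatrix (Fin.cons i I : Fin (l + 1) → Fin m) id).rank : ℝ) -
              (A.submatrix I id).rank := by
            rw [le_sub_iff_add_le']
            exact_mod_cast h1
          exact (sum_sq_norm_toEuclideanLin_apply_le A hb i).trans
            ((hM i).trans (le_mul_of_one_le_right hM0 h2))
        · push Not at h
          have h1 : ((A.submatrix I id).rank : ℝ) ≤
              (A.submatrix (Fin.cons i I : Fin (l + 1) → Fin m) id).rank := by
            exact_mod_cast rank_submatrix_le_cons A I i
          simp only [h, norm_zero, ne_eq, OfNat.ofNat_ne_zero, not_false_eq_true, zero_pow,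
            Finset.sum_const_zero]
          exact mul_nonneg hM0 (sub_nonneg.2 h1)
    _ = _ := by rw [Finset.mul_sum]

/-- The same Bessel argument on all of $(\ker A)^\perp$; it later absorbs the prefactor $k$ into
$\|A\|_F^2/\sigma^2$. -/
theorem rank_mul_sq_le (A : Matrix (Fin m) (Fin n) 𝕜) {σ : ℝ} (hσ0 : 0 ≤ σ)
    (hσ : ∀ v ∈ (LinearMap.ker (Matrix.toEuclideanLin A))ᗮ,
      σ * ‖v‖ ≤ ‖Matrix.toEuclideanLin A v‖) :
    A.rank * σ ^ 2 ≤ ∑ i, rowNorm A i ^ 2 := by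
  set T := Matrix.toEuclideanLin A with hT
  set V := (LinearMap.ker T)ᗮ with hV
  have hfin : Module.finrank 𝕜 V = A.rank := by
    have h0 := Submodule.finrank_add_finrank_orthogonal (LinearMap.ker T)
    have h1 := finrank_ker_toEuclideanLin_add_rank A
    rw [finrank_euclideanSpace_fin, ← hV] at h0
    rw [← hT] at h1
    omega
  set b := stdOrthonormalBasis 𝕜 V
  have hb : Orthonormal 𝕜 fun t => (b t : EuclideanSpace 𝕜 (Fin n)) :=
    b.orthonormal.comp_linearIsometry V.subtypeₗᵢ
  calc A.rank * σ ^ 2 = ∑ _t : Fin (Module.finrank 𝕜 V), σ ^ 2 := by simp [hfin]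
    _ ≤ ∑ t, ‖T (b t)‖ ^ 2 := by
        refine Finset.sum_le_sum fun t _ => ?_
        have h := hσ (b t) (b t).2
        rw [hb.norm_eq_one t, mul_one] at h
        gcongr
    _ = ∑ i, ∑ t, ‖T (b t) i‖ ^ 2 := by
        simp_rw [EuclideanSpace.norm_sq_eq]
        exact Finset.sum_comm
    _ ≤ _ := Finset.sum_le_sum fun i _ => sum_sq_norm_toEuclideanLin_apply_le A hb i

/-- Unnormalised expectation: dividing by $m^d$ gives the geometric decay of the mean deficit. -/
theorem sum_deficit_le (A : Matrix (Fin m) (Fin n) 𝕜) {σ M : ℝ} (hσ0 : 0 ≤ σ)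
    (hσ : ∀ v ∈ (LinearMap.ker (Matrix.toEuclideanLin A))ᗮ,
      σ * ‖v‖ ≤ ‖Matrix.toEuclideanLin A v‖)
    (hM0 : 0 < M) (hM : ∀ i, rowNorm A i ^ 2 ≤ M) (hσM : σ ^ 2 / M ≤ m) (d : ℕ) :
    ∑ I : Fin d → Fin m, ((A.rank : ℝ) - (A.submatrix I id).rank) ≤
      A.rank * (m - σ ^ 2 / M) ^ d := by
  induction d with
  | zero => simp
  | succ d ih =>
    rw [← (Fin.consEquiv fun _ : Fin (d + 1) => Fin m).sum_comp, Fintype.sum_prod_type_right]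
    calc _ ≤ ∑ I : Fin d → Fin m,
          (m - σ ^ 2 / M) * ((A.rank : ℝ) - (A.submatrix I id).rank) := by
          refine Finset.sum_le_sum fun I _ => ?_
          have h := deficit_mul_sq_le A hσ0 hσ hM I
          have h' : ((A.rank : ℝ) - (A.submatrix I id).rank) * (σ ^ 2 / M) ≤
              ∑ i : Fin m, (((A.submatrix (Fin.cons i I : Fin (d + 1) → Fin m) id).rank : ℝ) -
                (A.submatrix I id).rank) := by
            rwa [← mul_div_assoc, div_le_iff₀' hM0]
          change ∑ i : Fin m, ((A.rank : ℝ) -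
            (A.submatrix (Fin.cons i I : Fin (d + 1) → Fin m) id).rank) ≤ _
          simp only [Finset.sum_sub_distrib, Finset.sum_const, Finset.card_univ, Fintype.card_fin,
            nsmul_eq_mul] at h' ⊢
          linarith
      _ = (m - σ ^ 2 / M) * ∑ I : Fin d → Fin m, ((A.rank : ℝ) - (A.submatrix I id).rank) := by
          rw [Finset.mul_sum]
      _ ≤ (m - σ ^ 2 / M) * (A.rank * (m - σ ^ 2 / M) ^ d) :=
          mul_le_mul_of_nonneg_left ih (sub_nonneg.2 hσM)
      _ = _ := by ring

end RankGrowth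

/-! ### From counting index lists to probabilities -/

section Sampling

theorem isProbabilityMeasure_uniformSample (d : ℕ) {N : ℕ} (hN : 0 < N) :
    MeasureTheory.IsProbabilityMeasure (uniformSample d N) := by
  have : Nonempty (Fin N) := ⟨⟨0, hN⟩⟩
  unfold uniformSample
  infer_instance

theorem uniformSample_real_singleton {d N : ℕ} (hN : 0 < N) (I : Fin d → Fin N) :
    (uniformSample d N).real {I} = ((N : ℝ) ^ d)⁻¹ := by
  rw [MeasureTheory.measureReal_def, uniformSample]
  have hsing : ∀ i : Fin N, ((ProbabilityTheory.uniformOn Set.univ : MeasureTheory.Measure (Fin N)) {i})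
      = (N : ENNReal)⁻¹ := fun i => by
    rw [ProbabilityTheory.uniformOn_univ]
    simp
  have : Nonempty (Fin N) := ⟨⟨0, hN⟩⟩
  rw [MeasureTheory.Measure.pi_singleton]
  rw [Finset.prod_congr rfl fun t _ => hsing (I t)]
  simp

theorem uniformSample_real_eq {d N : ℕ} (hN : 0 < N) (p : (Fin d → Fin N) → Prop)
    [DecidablePred p] :
    (uniformSample d N).real {I | p I} = (Finset.univ.filter p).card * ((N : ℝ) ^ d)⁻¹ := by
  have := isProbabilityMeasure_uniformSample d hN
  have h : {I | p I} = ((Finset.univ.filter p : Finset (Fin d → Fin N)) : Set (Fin d → Fin N)) := by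
    ext; simp
  rw [h, ← MeasureTheory.sum_measureReal_singleton]
  simp [uniformSample_real_singleton hN]

theorem uniformSample_real_rank_ne_le {𝕜 : Type*} [RCLike 𝕜] {m n : ℕ} (hm : 0 < m)
    (A : Matrix (Fin m) (Fin n) 𝕜) {σ M : ℝ} (hσ0 : 0 ≤ σ)
    (hσ : ∀ v ∈ (LinearMap.ker (Matrix.toEuclideanLin A))ᗮ,
      σ * ‖v‖ ≤ ‖Matrix.toEuclideanLin A v‖)
    (hM0 : 0 < M) (hM : ∀ i, rowNorm A i ^ 2 ≤ M) (hσM : σ ^ 2 / M ≤ m) (d : ℕ) :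
    (uniformSample d m).real {I | (A.submatrix I id).rank ≠ A.rank} ≤
      A.rank * Real.exp (-(d * (σ ^ 2 / (m * M)))) := by
  classical
  have hm' : (0 : ℝ) < m := Nat.cast_pos.2 hm
  rw [uniformSample_real_eq hm]
  have hcard : ((Finset.univ.filter fun I : Fin d → Fin m =>
      (A.submatrix I id).rank ≠ A.rank).card : ℝ) ≤ A.rank * (m - σ ^ 2 / M) ^ d := by
    -- Markov's inequality: the deficit is a natural number, so it is at least 1 whenever it is
    -- nonzero.
    refine le_trans ?_ (sum_deficit_le A hσ0 hσ hM0 hM hσM d)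
    rw [Finset.card_filter, Nat.cast_sum]
    refine Finset.sum_le_sum fun I _ => ?_
    have h := rank_submatrix_row_le A I
    split_ifs with h'
    · rw [Nat.cast_one, le_sub_iff_add_le']
      exact_mod_cast lt_of_le_of_ne h h'
    · rw [Nat.cast_zero, sub_nonneg]
      exact_mod_cast h
  calc _ ≤ A.rank * (m - σ ^ 2 / M) ^ d * ((m : ℝ) ^ d)⁻¹ := by gcongr
    _ = A.rank * (1 - σ ^ 2 / (m * M)) ^ d := by
        rw [mul_assoc, ← inv_pow, ← mul_pow]
        congr 2
        field_simp
    _ ≤ A.rank * Real.exp (-(σ ^ 2 / (m * M))) ^ d := by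
        gcongr
        · rw [sub_nonneg, div_le_one (by positivity)]
          exact (div_le_iff₀ hM0).1 hσM
        · exact Real.one_sub_le_exp_neg _
    _ = _ := by rw [← Real.exp_nat_mul, mul_neg]

end Sampling

/-! ### Singular values as stretching bounds -/

section SingularValues

variable {𝕜 : Type*} [RCLike 𝕜] {E F : Type*}
  [NormedAddCommGroup E] [InnerProductSpace 𝕜 E] [FiniteDimensional 𝕜 E]
  [NormedAddCommGroup F] [InnerProductSpace 𝕜 F] [FiniteDimensional 𝕜 F]

theorem LinearMap.norm_apply_sq_eq_sum_singularValues (T : E →ₗ[𝕜] F) (v : E) :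
    ‖T v‖ ^ 2 = ∑ i : Fin (Module.finrank 𝕜 E), T.singularValues i ^ 2 *
      ‖inner 𝕜 (T.isSymmetric_adjoint_comp_self.eigenvectorBasis rfl i) v‖ ^ 2 := by
  set hS := T.isSymmetric_adjoint_comp_self
  set b := hS.eigenvectorBasis rfl with hb
  have h1 : ((‖T v‖ ^ 2 : ℝ) : 𝕜) = inner 𝕜 v ((LinearMap.adjoint T ∘ₗ T) v) := by
    rw [LinearMap.comp_apply, LinearMap.adjoint_inner_right, inner_self_eq_norm_sq_to_K]
    norm_cast
  have h2 : inner 𝕜 v ((LinearMap.adjoint T ∘ₗ T) v) =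
      ((∑ i : Fin (Module.finrank 𝕜 E), T.singularValues i ^ 2 * ‖inner 𝕜 (b i) v‖ ^ 2 : ℝ) : 𝕜) := by
    rw [← b.sum_inner_mul_inner, RCLike.ofReal_sum]
    refine Finset.sum_congr rfl fun i _ => ?_
    rw [← b.repr_apply_apply ((LinearMap.adjoint T ∘ₗ T) v), hb,
      hS.eigenvectorBasis_apply_self_apply rfl, OrthonormalBasis.repr_apply_apply,
      T.sq_singularValues_fin rfl, mul_left_comm, ← inner_conj_symm, RCLike.conj_mul]
    push_cast
    rfl
  rw [h2] at h1
  exact_mod_cast h1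

theorem LinearMap.norm_apply_le_singularValues_zero (T : E →ₗ[𝕜] F) (v : E) :
    ‖T v‖ ≤ T.singularValues 0 * ‖v‖ := by
  refine le_of_sq_le_sq ?_ (mul_nonneg (T.singularValues_nonneg 0) (norm_nonneg v))
  rw [T.norm_apply_sq_eq_sum_singularValues, mul_pow,
    ← (T.isSymmetric_adjoint_comp_self.eigenvectorBasis rfl).sum_sq_norm_inner_right v,
    Finset.mul_sum]
  refine Finset.sum_le_sum fun i _ => ?_
  gcongr
  · exact T.singularValues_nonneg _
  · exact T.singularValues_antitone (Nat.zero_le _)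

theorem LinearMap.singularValues_mul_norm_le (T : E →ₗ[𝕜] F) {v : E}
    (hv : v ∈ (LinearMap.ker T)ᗮ) :
    T.singularValues (Module.finrank 𝕜 T.range - 1) * ‖v‖ ≤ ‖T v‖ := by
  refine le_of_sq_le_sq ?_ (norm_nonneg _)
  rw [T.norm_apply_sq_eq_sum_singularValues, mul_pow,
    ← (T.isSymmetric_adjoint_comp_self.eigenvectorBasis rfl).sum_sq_norm_inner_right v,
    Finset.mul_sum]
  refine Finset.sum_le_sum fun i _ => ?_
  by_cases hi : (i : ℕ) < Module.finrank 𝕜 T.range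
  · gcongr
    · exact T.singularValues_nonneg _
    · exact T.singularValues_antitone (by omega)
  -- Eigenvectors past the rank lie in the kernel, so `v` has no component along them.
  · have h0 : T.singularValues i = 0 :=
      T.singularValues_eq_zero_iff_le_finrank_range.2 (not_lt.1 hi)
    have hker : T.isSymmetric_adjoint_comp_self.eigenvectorBasis rfl i ∈ LinearMap.ker T := by
      rw [← LinearMap.ker_adjoint_comp_self, LinearMap.mem_ker,
        T.isSymmetric_adjoint_comp_self.apply_eigenvectorBasis, ← T.sq_singularValues_fin rfl, h0]
      simp
    rw [(Submodule.mem_orthogonal _ _).1 hv _ hker]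
    simp

/-- A lower bound of `T` on the orthogonal complement of its kernel passes to the adjoint. -/
theorem LinearMap.mul_norm_le_norm_adjoint_apply (T : E →ₗ[𝕜] F) {σ : ℝ} (hσ : 0 ≤ σ)
    (h : ∀ v ∈ (LinearMap.ker T)ᗮ, σ * ‖v‖ ≤ ‖T v‖) :
    ∀ w ∈ (LinearMap.ker (LinearMap.adjoint T))ᗮ, σ * ‖w‖ ≤ ‖LinearMap.adjoint T w‖ := by
  intro w hw
  rw [← LinearMap.orthogonal_range, Submodule.orthogonal_orthogonal] at hw
  obtain ⟨u, rfl⟩ := hw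
  obtain ⟨y, hy, v, hv, rfl⟩ := Submodule.exists_add_mem_mem_orthogonal (K := LinearMap.ker T) u
  rw [map_add, LinearMap.mem_ker.1 hy, zero_add]
  rcases eq_or_ne (T v) 0 with h0 | h0
  · simp [h0]
  have hpos : 0 < ‖T v‖ := norm_pos_iff.2 h0
  -- Cauchy–Schwarz for $\|Tv\|^2=\langle T^*Tv,v\rangle$, where `v` is the part of `u` orthogonal
  -- to the kernel.
  have h1 : ‖T v‖ ^ 2 ≤ ‖LinearMap.adjoint T (T v)‖ * ‖v‖ := by
    have e : inner 𝕜 (LinearMap.adjoint T (T v)) v = ((‖T v‖ ^ 2 : ℝ) : 𝕜) := by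
      rw [LinearMap.adjoint_inner_left, inner_self_eq_norm_sq_to_K]
      norm_cast
    have := norm_inner_le_norm (𝕜 := 𝕜) (LinearMap.adjoint T (T v)) v
    rwa [e, RCLike.norm_ofReal, abs_of_nonneg (sq_nonneg _)] at this
  refine le_of_mul_le_mul_right ?_ hpos
  calc σ * ‖T v‖ * ‖T v‖ = σ * ‖T v‖ ^ 2 := by ring
    _ ≤ σ * (‖LinearMap.adjoint T (T v)‖ * ‖v‖) := by gcongr
    _ = ‖LinearMap.adjoint T (T v)‖ * (σ * ‖v‖) := by ring
    _ ≤ _ := by gcongr; exact h v hv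

end SingularValues

/-! ### Full-rank rows and columns give an exact CUR decomposition -/

section Exactness

variable {𝕜 : Type*} [RCLike 𝕜] {m n : ℕ}

theorem exists_mul_submatrix_row_eq {l : ℕ} (A : Matrix (Fin m) (Fin n) 𝕜) (I : Fin l → Fin m)
    (h : (A.submatrix I id).rank = A.rank) :
    ∃ X : Matrix (Fin m) (Fin l) 𝕜, A = X * A.submatrix I id := by
  have hle : Submodule.span 𝕜 (Set.range (A.submatrix I id).row) ≤
      Submodule.span 𝕜 (Set.range A.row) :=
    Submodule.span_mono (by rintro _ ⟨t, rfl⟩; exact ⟨I t, rfl⟩)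
  have heq := Submodule.eq_of_le_of_finrank_eq hle (by
    rw [← Matrix.rank_eq_finrank_span_row, ← Matrix.rank_eq_finrank_span_row, h])
  have hmem : ∀ i, ∃ c : Fin l → 𝕜, ∑ t, c t • A (I t) = A i := fun i => by
    have : A i ∈ Submodule.span 𝕜 (Set.range (A.submatrix I id).row) :=
      heq ▸ Submodule.subset_span ⟨i, rfl⟩
    exact (Submodule.mem_span_range_iff_exists_fun 𝕜).1 this
  choose X hX using hmem
  refine ⟨Matrix.of X, ?_⟩
  ext i j
  rw [← hX i, Matrix.mul_apply]
  simp

theorem exists_submatrix_col_mul_eq {l : ℕ} (A : Matrix (Fin m) (Fin n) 𝕜) (J : Fin l → Fin n)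
    (h : (A.submatrix id J).rank = A.rank) :
    ∃ Y : Matrix (Fin l) (Fin n) 𝕜, A = A.submatrix id J * Y := by
  obtain ⟨X, hX⟩ := exists_mul_submatrix_row_eq Aᵀ J (by
    rw [← Matrix.transpose_submatrix, Matrix.rank_transpose, Matrix.rank_transpose, h])
  refine ⟨Xᵀ, ?_⟩
  have := congrArg Matrix.transpose hX
  simpa [Matrix.transpose_mul] using this

theorem isExactCUR_of_rank_eq {d₁ d₂ : ℕ} (A : Matrix (Fin m) (Fin n) 𝕜) (I : Fin d₁ → Fin m)
    (J : Fin d₂ → Fin n) (hI : (A.submatrix I id).rank = A.rank)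
    (hJ : (A.submatrix id J).rank = A.rank) : IsExactCUR A I J := by
  obtain ⟨X, hX⟩ := exists_mul_submatrix_row_eq A I hI
  obtain ⟨Y, hY⟩ := exists_submatrix_col_mul_eq A J hJ
  set U := A.submatrix I J with hU
  have hC : A.submatrix id J = X * U := by
    conv_lhs => rw [hX]
    ext i j
    simp [Matrix.mul_apply, hU]
  have hR : A.submatrix I id = U * Y := by
    conv_lhs => rw [hY]
    ext i j
    simp [Matrix.mul_apply, hU]
  refine ⟨le_antisymm ?_ ?_, ?_⟩
  · rw [← hJ, hC]
    have := rank_submatrix_row_le (A.submatrix id J) I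
    rw [← hC]
    exact this
  · rw [← hI, hR]
    exact Matrix.rank_mul_le_left _ _
  · rw [hC, hR, ← hU]
    calc A = X * (U * Y) := by rw [← hR, ← hX]
      _ = X * (U * pinv U * U) * Y := by
          rw [(isMoorePenrose_pinv U).mul_mul_self, Matrix.mul_assoc]
      _ = _ := by simp only [Matrix.mul_assoc]

end Exactness

/-! ### Norms, row and column parameters, extreme singular values -/

section Parameters

variable {𝕜 : Type*} [RCLike 𝕜] {m n : ℕ}

theorem frobNorm_sq (A : Matrix (Fin m) (Fin n) 𝕜) :
    frobNorm A ^ 2 = ∑ i, rowNorm A i ^ 2 := by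
  have h : ∀ i, rowNorm A i ^ 2 = ∑ j, ‖A i j‖ ^ 2 := fun i =>
    Real.sq_sqrt (Finset.sum_nonneg fun j _ => sq_nonneg _)
  simp only [h]
  rw [frobNorm, Matrix.frobenius_norm_def, ← Real.sqrt_eq_rpow, Real.sq_sqrt (by positivity)]
  simp

theorem frobNorm_conjTranspose (A : Matrix (Fin m) (Fin n) 𝕜) : frobNorm Aᴴ = frobNorm A :=
  Matrix.frobenius_norm_conjTranspose A

theorem rowNorm_conjTranspose (A : Matrix (Fin m) (Fin n) 𝕜) (j : Fin n) :
    rowNorm Aᴴ j = colNorm A j := by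
  simp [rowNorm, colNorm]

theorem rowParam_conjTranspose (A : Matrix (Fin m) (Fin n) 𝕜) : rowParam Aᴴ = colParam A := by
  simp [rowParam, colParam, rowNorm_conjTranspose, frobNorm_conjTranspose]

theorem rowParam_sq_mul_le (A : Matrix (Fin m) (Fin n) 𝕜) (hm : 0 < m) (i : Fin m) :
    rowParam A ^ 2 * (m * rowNorm A i ^ 2) ≤ frobNorm A ^ 2 := by
  have hm' : (0 : ℝ) < m := Nat.cast_pos.2 hm
  have hF : 0 ≤ frobNorm A := by
    rw [frobNorm, Matrix.frobenius_norm_def]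
    positivity
  by_cases h : ∃ j, A i j ≠ 0
  · obtain ⟨j, hj⟩ := h
    have hr : 0 < rowNorm A i := Real.sqrt_pos.2 <| Finset.sum_pos'
      (fun _ _ => sq_nonneg _) ⟨j, Finset.mem_univ _, by positivity⟩
    set S := {x : ℝ | ∃ i : Fin m, (∃ j, A i j ≠ 0) ∧ x = frobNorm A / rowNorm A i} with hS
    have hnn : ∀ x ∈ S, 0 ≤ x := by
      rintro _ ⟨i, -, rfl⟩
      exact div_nonneg hF (Real.sqrt_nonneg _)
    have h0 : 0 ≤ sInf S := Real.sInf_nonneg hnn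
    have h1 : sInf S ≤ frobNorm A / rowNorm A i := csInf_le ⟨0, hnn⟩ ⟨i, ⟨j, hj⟩, rfl⟩
    have h2 : rowParam A ^ 2 * m = sInf S ^ 2 := by
      rw [rowParam, ← hS, mul_pow, div_pow, Real.sq_sqrt hm'.le]
      field_simp
    rw [← mul_assoc, h2, ← mul_pow]
    exact pow_le_pow_left₀ (by positivity) ((le_div_iff₀ hr).1 h1) 2
  · push Not at h
    simp [rowNorm, h, hF]

theorem frobNorm_pos {A : Matrix (Fin m) (Fin n) 𝕜} (hA : A ≠ 0) : 0 < frobNorm A := by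
  let _ : NormedAddCommGroup (Matrix (Fin m) (Fin n) 𝕜) := Matrix.frobeniusNormedAddCommGroup
  exact norm_pos_iff.2 hA

/-- Sum `rowParam_sq_mul_le` over the rows: the maximal squared row norm is at least the average. -/
theorem rowParam_sq_le_one {A : Matrix (Fin m) (Fin n) 𝕜} (hA : A ≠ 0) (hm : 0 < m) :
    rowParam A ^ 2 ≤ 1 := by
  have hm' : (0 : ℝ) < m := Nat.cast_pos.2 hm
  have hF := frobNorm_pos hA
  have h := Finset.sum_le_sum fun i (_ : i ∈ Finset.univ) => rowParam_sq_mul_le A hm i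
  rw [← Finset.mul_sum, ← Finset.mul_sum, ← frobNorm_sq] at h
  simp only [Finset.sum_const, Finset.card_univ, Fintype.card_fin, nsmul_eq_mul] at h
  have : rowParam A ^ 2 * (m * frobNorm A ^ 2) ≤ 1 * (m * frobNorm A ^ 2) := by linarith
  exact le_of_mul_le_mul_right this (by positivity)

theorem specNorm_le_singVal_zero (A : Matrix (Fin m) (Fin n) 𝕜) : specNorm A ≤ singVal A 0 :=
  ContinuousLinearMap.opNorm_le_bound _ (LinearMap.singularValues_nonneg _ _)
    (Matrix.toEuclideanLin A).norm_apply_le_singularValues_zero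

theorem specNorm_pos {A : Matrix (Fin m) (Fin n) 𝕜} (hA : A ≠ 0) : 0 < specNorm A := by
  let _ : NormedAddCommGroup (Matrix (Fin m) (Fin n) 𝕜) := Matrix.instL2OpNormedAddCommGroup
  exact norm_pos_iff.2 hA

theorem singVal_mul_norm_le (A : Matrix (Fin m) (Fin n) 𝕜) :
    ∀ v ∈ (LinearMap.ker (Matrix.toEuclideanLin A))ᗮ,
      singVal A (A.rank - 1) * ‖v‖ ≤ ‖Matrix.toEuclideanLin A v‖ := fun v hv => by
  have := (Matrix.toEuclideanLin A).singularValues_mul_norm_le hv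
  rwa [finrank_range_toEuclideanLin] at this

theorem Matrix.rank_pos_of_ne_zero {A : Matrix (Fin m) (Fin n) 𝕜} (hA : A ≠ 0) : 0 < A.rank := by
  rw [Nat.pos_iff_ne_zero, ← finrank_range_toEuclideanLin, Ne, Submodule.finrank_eq_zero,
    LinearMap.range_eq_bot, LinearEquiv.map_eq_zero_iff]
  exact hA

theorem singVal_rank_pos {A : Matrix (Fin m) (Fin n) 𝕜} (hA : A ≠ 0) :
    0 < singVal A (A.rank - 1) := by
  rw [singVal, LinearMap.singularValues_pos_iff_lt_finrank_range, finrank_range_toEuclideanLin]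
  exact Nat.sub_lt (Matrix.rank_pos_of_ne_zero hA) one_pos

theorem singVal_mul_norm_conjTranspose_le (A : Matrix (Fin m) (Fin n) 𝕜) :
    ∀ v ∈ (LinearMap.ker (Matrix.toEuclideanLin Aᴴ))ᗮ,
      singVal A (A.rank - 1) * ‖v‖ ≤ ‖Matrix.toEuclideanLin Aᴴ v‖ := by
  rw [Matrix.toEuclideanLin_conjTranspose_eq_adjoint]
  exact LinearMap.mul_norm_le_norm_adjoint_apply _ (LinearMap.singularValues_nonneg _ _)
    (singVal_mul_norm_le A)

end Parameters

/-! ### Tail bound and assembly -/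

/-- Uniformly sampled rows of `A` have full rank with high probability. -/
theorem le_uniformSample_real_rank_eq {𝕜 : Type*} [RCLike 𝕜] {m n : ℕ}
    {A : Matrix (Fin m) (Fin n) 𝕜} (hA : A ≠ 0) {σ r ε δ : ℝ} (hσ0 : 0 < σ)
    (hσ : ∀ v ∈ (LinearMap.ker (Matrix.toEuclideanLin A))ᗮ,
      σ * ‖v‖ ≤ ‖Matrix.toEuclideanLin A v‖)
    (hε0 : 0 < ε) (hε1 : ε ≤ 1) (hδ0 : 0 < δ) (hδ1 : δ < 1)
    (hr : frobNorm A ^ 2 / σ ^ 2 ≤ r / ε ^ 2) {d : ℕ}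
    (hd : r / (ε ^ 4 * δ) * Real.log (r / (ε ^ 4 * δ)) ≤ d) :
    max 0 (1 - 2 * Real.exp (-(1 / 8 * rowParam A ^ 2 / δ))) ≤
      (uniformSample d m).real {I | (A.submatrix I id).rank = A.rank} := by
  have hm : 0 < m := by
    rcases Nat.eq_zero_or_pos m with rfl | h
    · exact absurd (Matrix.ext fun i => i.elim0) hA
    · exact h
  have hm' : (0 : ℝ) < m := Nat.cast_pos.2 hm
  have := isProbabilityMeasure_uniformSample d hm
  refine max_le MeasureTheory.measureReal_nonneg ?_
  have hcompl : (uniformSample d m).real {I | (A.submatrix I id).rank = A.rank} =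
      1 - (uniformSample d m).real {I | (A.submatrix I id).rank ≠ A.rank} := by
    rw [← MeasureTheory.probReal_compl_eq_one_sub (Set.toFinite _).measurableSet]
    congr 1
    ext I
    simp
  rw [hcompl]
  have hα1 := rowParam_sq_le_one hA hm
  have hαM := rowParam_sq_mul_le A hm
  set a := rowParam A ^ 2 with ha
  by_cases htriv : 1 ≤ 2 * Real.exp (-(1 / 8 * a / δ))
  · have := MeasureTheory.measureReal_le_one (μ := uniformSample d m)
      (s := {I | (A.submatrix I id).rank ≠ A.rank})
    linarith
  push Not at htriv
  set y := a / δ with hy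
  -- For $y\le 4$, $2e^{-y/8}\ge 2(1-y/8)\ge 1$ and the claim is trivial.
  have hy4 : 4 < y := by
    by_contra h
    have h1 := Real.one_sub_le_exp_neg (1 / 8 * a / δ)
    rw [mul_div_assoc, ← hy] at h1 htriv
    linarith
  have ha4 : 4 * δ < a := (lt_div_iff₀ hδ0).1 hy4
  have ha0 : 0 < a := by linarith
  have hF := frobNorm_pos hA
  set N := frobNorm A ^ 2 / σ ^ 2 with hN
  have hkN : (A.rank : ℝ) ≤ N := by
    rw [hN, le_div_iff₀ (by positivity), frobNorm_sq]
    exact rank_mul_sq_le A hσ0.le hσ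
  have hk1 : (1 : ℝ) ≤ A.rank := by exact_mod_cast Matrix.rank_pos_of_ne_zero hA
  have hN0 : 0 < N := by linarith
  set s := r / (ε ^ 4 * δ) with hs
  have hsN : N / δ ≤ s := by
    have h1 : s = r / ε ^ 2 / (ε ^ 2 * δ) := by
      rw [hs, div_div]
      congr 1
      ring
    rw [h1]
    have h2 : ε ^ 2 * δ ≤ δ := mul_le_of_le_one_left hδ0.le (pow_le_one₀ hε0.le hε1)
    exact div_le_div₀ (hN0.le.trans hr) hr (by positivity) h2
  have hNs : N ≤ s := (le_div_self hN0.le hδ0 hδ1.le).trans hsN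
  -- $s\ge N/\delta\ge 1/\delta$, and $4\delta<\alpha^2\le 1$.
  have hs4 : 4 ≤ s := by
    refine le_trans ?_ hsN
    rw [le_div_iff₀ hδ0]
    linarith
  have hs0 : 0 < s := by linarith
  have hL1 : 1 ≤ Real.log s := by
    rw [Real.le_log_iff_exp_le hs0]
    linarith [Real.exp_one_lt_d9]
  -- The row-norm bound encoded in $\alpha$; it makes the success rate per draw $\alpha^2/N$.
  set M := frobNorm A ^ 2 / (m * a) with hMdef
  have hM0 : 0 < M := by positivity
  have hM : ∀ i, rowNorm A i ^ 2 ≤ M := fun i => by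
    rw [hMdef, le_div_iff₀ (by positivity)]
    linarith [hαM i]
  have hp : σ ^ 2 / (m * M) = a / N := by
    rw [hMdef, hN]
    field_simp
  have hσM : σ ^ 2 / M ≤ m := by
    have h1 : σ ^ 2 / M = m * (a / N) := by
      rw [← hp]
      field_simp
    rw [h1]
    exact mul_le_of_le_one_right hm'.le ((div_le_one hN0).2 (by linarith))
  have hfail := uniformSample_real_rank_ne_le hm A hσ0.le hσ hM0 hM hσM d
  rw [hp] at hfail
  have hexp : Real.log s * y ≤ d * (a / N) := by
    calc Real.log s * y = N / δ * Real.log s * (a / N) := by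
          rw [hy]
          field_simp
      _ ≤ s * Real.log s * (a / N) := by gcongr
      _ ≤ d * (a / N) := by gcongr
  -- Since $k\le s$, failure is at most $s^{1-y}$; now $\log s\ge 1$ and $y-1\ge y/8$.
  have hbound : (A.rank : ℝ) * Real.exp (-(d * (a / N))) ≤ Real.exp (-(1 / 8 * a / δ)) := by
    calc (A.rank : ℝ) * Real.exp (-(d * (a / N)))
        ≤ Real.exp (Real.log s) * Real.exp (-(Real.log s * y)) := by
          rw [Real.exp_log hs0]
          gcongr
          exact hkN.trans hNs
      _ = Real.exp (-(Real.log s * (y - 1))) := by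
          rw [← Real.exp_add]
          congr 1
          ring
      _ ≤ _ := by
          rw [Real.exp_le_exp, neg_le_neg_iff, mul_div_assoc, ← hy]
          nlinarith
  linarith [Real.exp_pos (-(1 / 8 * a / δ))]

theorem le_one_and_frobNorm_sq_div_singVal_sq_le {𝕜 : Type*} [RCLike 𝕜] {m n : ℕ}
    {A : Matrix (Fin m) (Fin n) 𝕜} (hA : A ≠ 0) {ε : ℝ} (hε0 : 0 < ε) (hε : ε < (condNum A)⁻¹) :
    ε ≤ 1 ∧ frobNorm A ^ 2 / singVal A (A.rank - 1) ^ 2 ≤ stableRank A / ε ^ 2 := by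
  have hσ := singVal_rank_pos hA
  have hle : singVal A (A.rank - 1) ≤ singVal A 0 :=
    LinearMap.singularValues_antitone _ (Nat.zero_le _)
  have h0 : 0 < singVal A 0 := hσ.trans_le hle
  have hS := specNorm_pos hA
  have hSle := specNorm_le_singVal_zero A
  rw [condNum, inv_div, lt_div_iff₀ h0] at hε
  refine ⟨le_of_mul_le_mul_right (by linarith) h0, ?_⟩
  rw [stableRank, div_div, ← mul_pow]
  gcongr
  -- $\varepsilon\|A\|_2\le\varepsilon\sigma_{\max}\le\sigma_{\min}$.
  nlinarith

open scoped ComplexOrder in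
theorem rank_conjTranspose_submatrix_eq_iff {𝕜 : Type*} [RCLike 𝕜] {m n d : ℕ}
    (A : Matrix (Fin m) (Fin n) 𝕜) (J : Fin d → Fin n) :
    (Aᴴ.submatrix J id).rank = Aᴴ.rank ↔ (A.submatrix id J).rank = A.rank := by
  rw [← Matrix.conjTranspose_submatrix, Matrix.rank_conjTranspose, Matrix.rank_conjTranspose]

theorem mainTheorem3 :
    ∃ c₀ : ℝ, 0 < c₀ ∧ ∃ c : ℝ, 0 < c ∧
      ∀ (𝕜 : Type) [RCLike 𝕜] (m n : ℕ) (A : Matrix (Fin m) (Fin n) 𝕜), A ≠ 0 →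
      ∀ α β : ℝ, α = rowParam A → β = colParam A →
      ∀ δ ε : ℝ, 0 < δ → δ < 1 → 0 < ε →
        ε < min (condNum A)⁻¹ (δ ^ (-(1 / 4) : ℝ) * √(2 * min α β)) →
      ∀ d₁ d₂ : ℕ,
        c₀ * ((stableRank A / (ε ^ 4 * δ)) * Real.log (stableRank A / (ε ^ 4 * δ))) ≤ (d₁ : ℝ) →
        c₀ * ((stableRank A / (ε ^ 4 * δ)) * Real.log (stableRank A / (ε ^ 4 * δ))) ≤ (d₂ : ℝ) →
        max 0 (1 - 2 * Real.exp (-(c * α ^ 2 / δ))) * max 0 (1 - 2 * Real.exp (-(c * β ^ 2 / δ))) ≤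
          ((uniformSample d₁ m).prod (uniformSample d₂ n)).real
            {S : (Fin d₁ → Fin m) × (Fin d₂ → Fin n) | IsExactCUR A S.1 S.2} := by
  refine ⟨1, one_pos, 1 / 8, by norm_num, ?_⟩
  rintro 𝕜 _ m n A hA _ _ rfl rfl δ ε hδ0 hδ1 hε0 hε d₁ d₂ hd₁ hd₂
  rw [one_mul] at hd₁ hd₂
  have hm : 0 < m := by
    rcases Nat.eq_zero_or_pos m with rfl | h
    · exact absurd (Matrix.ext fun i => i.elim0) hA
    · exact h
  have hn : 0 < n := by
    rcases Nat.eq_zero_or_pos n with rfl | h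
    · exact absurd (Matrix.ext fun _ j => j.elim0) hA
    · exact h
  have := isProbabilityMeasure_uniformSample d₁ hm
  have := isProbabilityMeasure_uniformSample d₂ hn
  obtain ⟨hε1, hr⟩ := le_one_and_frobNorm_sq_div_singVal_sq_le hA hε0 (hε.trans_le (min_le_left _ _))
  have hσ := singVal_rank_pos hA
  have h1 := le_uniformSample_real_rank_eq hA hσ (singVal_mul_norm_le A) hε0 hε1 hδ0 hδ1 hr hd₁
  have h2 := le_uniformSample_real_rank_eq (A := Aᴴ) (Matrix.conjTranspose_eq_zero.not.2 hA) hσ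
    (singVal_mul_norm_conjTranspose_le A) hε0 hε1 hδ0 hδ1
    (by rwa [frobNorm_conjTranspose]) hd₂
  rw [rowParam_conjTranspose] at h2
  calc _ ≤ _ := mul_le_mul h1 h2 (le_max_left _ _) MeasureTheory.measureReal_nonneg
    _ = ((uniformSample d₁ m).prod (uniformSample d₂ n)).real
          ({I | (A.submatrix I id).rank = A.rank} ×ˢ {J | (Aᴴ.submatrix J id).rank = Aᴴ.rank}) :=
        (MeasureTheory.measureReal_prod_prod _ _).symm
    _ ≤ _ := by
        refine MeasureTheory.measureReal_mono ?_
        rintro ⟨I, J⟩ ⟨hI, hJ⟩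
        refine isExactCUR_of_rank_eq A I J hI ?_
        exact (rank_conjTranspose_submatrix_eq_iff A J).1 hJ
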